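/- For an integer $z\neq 0$ its bitsize is $\lfloor\log_2|z|\rfloor+1$, and the bitsize of a polynomial with integer coefficients is the maximum bitsize of its nonzero coefficients. For $P\in\mathbb{Z}[X,Y]$ let $L_P(S)$ denote the leading coefficient of $P(T-SY,Y)$ with respect to $Y$ (it does not depend on $T$). Let $d\ge 2$ be an integer and let $P,Q\in\mathbb{Z}[X,Y]$ be nonzero coprime polynomials of total degree at most $d$; put $I=\langle P,Q\rangle$. For a prime $\mu$ let $I_\mu=\langle P \bmod \mu,\,Q\bmod\mu\rangle\subset(\mathbb{Z}/\mu\mathbb{Z})[X,Y]$, and let $\#V(I)$ and $\#V(I_\mu)\in\mathbb{N}\cup\{\infty\}$ be the numbers of distinct solutions of $I$ and of $I_\mu$ over an algebraic closure of $\mathbb{Q}$ and of $\mathbb{Z}/\mu\mathbb{Z}$, respectively. The prime $\mu$ is called lucky for $\langle P,Q\rangle$ (with respect to $d$) if $\mu>2d^4$, $L_P(S)\,L_Q(S)\not\equiv 0 \pmod \mu$ and $\#V(I)=\#V(I_\mu)$; otherwise $\mu$ is called unlucky. Proposition. An upper bound on the number of unlucky primes can be explicitly computed in terms of $d$ and of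 a bound $\tau$ on the bitsizes of $P$ and $Q$, and this bound is in $\widetilde{O}(d^4+d^3\tau)$. That is, there are a primitive recursive function $\Xi:\mathbb{N}\times\mathbb{N}\to\mathbb{N}$ and constants $C>0$ and $k\in\mathbb{N}$ with $$\Xi(d,\tau)\le C\,(d^4+d^3\tau)\,\bigl(\log_2(d+\tau)\bigr)^k\qquad\text{for all } d\ge 2,\ \tau\ge 1,$$ such that for all $d\ge2$ and $\tau$, and all nonzero coprime $P,Q\in\mathbb{Z}[X,Y]$ of total degree at most $d$ and bitsize at most $\tau$, the number of primes that are unlucky for $\langle P,Q\rangle$ is (finite and) at most $\Xi(d,\tau)$. -/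

import Mathlib

namespace LuckyPrimes

open MvPolynomial

/- Bivariate polynomials are elements of `MvPolynomial (Fin 2) R`: the variable `0` is `X`
and the variable `1` is `Y`. -/

/-- The bitsize `⌊log₂ |z|⌋ + 1` of an integer. -/
def intBitsize (z : ℤ) : ℕ := Nat.log 2 z.natAbs + 1

/-- The bitsize of an integer polynomial: the maximum bitsize of its (nonzero) coefficients. -/
def bitsize (P : MvPolynomial (Fin 2) ℤ) : ℕ := P.support.sup fun m => intBitsize (P.coeff m)

/-- The sheared polynomial `P(T - S Y, Y)`, as a polynomial in `Y` with coefficients in `ℤ[T, S]`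
(in the coefficient ring, the variable `0` is `T` and the variable `1` is `S`). -/
noncomputable def shear (P : MvPolynomial (Fin 2) ℤ) : Polynomial (MvPolynomial (Fin 2) ℤ) :=
  aeval ![Polynomial.C (X 0) - Polynomial.C (X 1) * Polynomial.X, Polynomial.X] P

/-- `L_P(S)`: the leading coefficient of `P(T - S Y, Y)` with respect to `Y`.
It is regarded as an element of `ℤ[T, S]` (in which the variable `T` does not occur). -/
noncomputable def shearLc (P : MvPolynomial (Fin 2) ℤ) : MvPolynomial (Fin 2) ℤ :=
  (shear P).leadingCoeff

/-- Reduction modulo `μ` of the coefficients of an integer polynomial. -/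
noncomputable def reduceMod (μ : ℕ) (P : MvPolynomial (Fin 2) ℤ) : MvPolynomial (Fin 2) (ZMod μ) :=
  MvPolynomial.map (Int.castRingHom (ZMod μ)) P

/-- The affine variety of the ideal `⟨P, Q⟩`: the set of the distinct common zeros of `P` and `Q`
in `K × K`, where `K` will be an algebraically closed field. -/
def variety {R : Type*} [CommRing R] (K : Type*) [Field K] [Algebra R K]
    (P Q : MvPolynomial (Fin 2) R) : Set (Fin 2 → K) :=
  {x | ∀ f ∈ Ideal.span {P, Q}, aeval x f = 0}

/-- The prime `μ` is lucky for `I = ⟨P, Q⟩` (with respect to the degree bound `d`): it is larger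
than `2 d ^ 4`, the product `L_P(S) L_Q(S)` does not vanish identically modulo `μ`, and `I` has as
many distinct solutions over the algebraic closure of `ℚ` as its reduction modulo `μ` has over the
algebraic closure of `ℤ/μℤ`. The cardinalities are in `ℕ ∪ {∞}`. -/
def IsLucky (d : ℕ) (P Q : MvPolynomial (Fin 2) ℤ) (μ : ℕ) [Fact μ.Prime] : Prop :=
  2 * d ^ 4 < μ ∧
  reduceMod μ (shearLc P) * reduceMod μ (shearLc Q) ≠ 0 ∧
  (variety (AlgebraicClosure ℚ) P Q).encard =
    (variety (AlgebraicClosure (ZMod μ)) (reduceMod μ P) (reduceMod μ Q)).encard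

/-- The set of the primes that are not lucky. -/
def unluckyPrimes (d : ℕ) (P Q : MvPolynomial (Fin 2) ℤ) : Set ℕ :=
  {μ | ∃ _ : Fact μ.Prime, ¬ IsLucky d P Q μ}

/-- `f(d, τ) ∈ Õ(g(d, τ))`: up to a constant and a polylogarithmic factor in `d` and `τ`, `f` is
bounded by `g`, uniformly for all `d ≥ 2` and `τ ≥ 1` (so that `log₂ (d + τ) ≥ 1`). -/
def IsSoftO (f g : ℕ → ℕ → ℝ) : Prop :=
  ∃ (C : ℝ) (k : ℕ), ∀ d τ : ℕ, 2 ≤ d → 1 ≤ τ →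
    |f d τ| ≤ C * |g d τ| * Real.logb 2 ((d : ℝ) + (τ : ℝ)) ^ k

end LuckyPrimes

/-! Shear by x + s y and eliminate Y: let f in ℤ[S][T] be the resultant of P(T - SY, Y) and Q(T -
SY, Y). It is nonzero because P and Q are coprime. If s is transcendental over an algebraically
closed field K, the form x + s y separates the points of K², and the roots of f at S = s are exactly
its values at the common zeros over K (`encard_zeros`). Hence #V is the number of distinct roots of
f(s, T).

This number is a rank. If f has degree n and the characteristic is 0 or larger than n, the matrix of
the shifts of f and f' has rank n plus the number of distinct roots (`rank_derivMatrix`). Fix a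
maximal minor D in ℤ[S] that is nonzero in characteristic 0. A prime modulo which D, the leading
coefficient of f and the two top forms all survive preserves the rank (`rank_map_eq`), the degree
and L_P L_Q, so it is lucky once it exceeds 2d⁴.

Therefore every unlucky prime above 2d⁴ divides one nonzero integer, the leading coefficient of the
product of these four polynomials (`exists_multiple_of_unlucky`). The sum of absolute values of
coefficients is submultiplicative and bounds this integer by 2^E with E = O(d⁴ + d³τ), so it has at
most E prime factors. The small primes add at most 2d⁴. -/

namespace LuckyPrimes

/-! ### Size functions on iterated polynomial rings -/

/-- A subadditive and submultiplicative size function on a ring. -/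
structure LengthFn (R : Type*) [CommRing R] where
  toFun : R → ℕ
  map_zero' : toFun 0 = 0
  map_one_le' : toFun 1 ≤ 1
  map_neg' : ∀ a, toFun (-a) = toFun a
  map_add_le' : ∀ a b, toFun (a + b) ≤ toFun a + toFun b
  map_mul_le' : ∀ a b, toFun (a * b) ≤ toFun a * toFun b

namespace LengthFn

variable {R : Type*} [CommRing R]

instance : CoeFun (LengthFn R) (fun _ => R → ℕ) := ⟨LengthFn.toFun⟩

variable (N : LengthFn R)

lemma map_zero : N 0 = 0 := N.map_zero'
lemma map_one_le : N 1 ≤ 1 := N.map_one_le'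
lemma map_neg (a : R) : N (-a) = N a := N.map_neg' a
lemma map_add_le (a b : R) : N (a + b) ≤ N a + N b := N.map_add_le' a b
lemma map_mul_le (a b : R) : N (a * b) ≤ N a * N b := N.map_mul_le' a b

lemma map_sub_le (a b : R) : N (a - b) ≤ N a + N b := by
  simpa [sub_eq_add_neg, N.map_neg] using N.map_add_le a (-b)

lemma map_sum_le {ι : Type*} (s : Finset ι) (g : ι → R) : N (∑ i ∈ s, g i) ≤ ∑ i ∈ s, N (g i) :=
  Finset.le_sum_of_subadditive N N.map_zero.le N.map_add_le s g

lemma map_prod_le {ι : Type*} (s : Finset ι) (g : ι → R) :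
    N (∏ i ∈ s, g i) ≤ ∏ i ∈ s, N (g i) := by
  classical
  induction s using Finset.induction_on with
  | empty => simpa using N.map_one_le
  | insert a s ha ih =>
    rw [Finset.prod_insert ha, Finset.prod_insert ha]
    exact (N.map_mul_le _ _).trans (Nat.mul_le_mul_left _ ih)

lemma map_pow_le (a : R) (n : ℕ) : N (a ^ n) ≤ N a ^ n := by
  simpa using N.map_prod_le (Finset.range n) fun _ => a

lemma map_natCast_le (n : ℕ) : N (n : R) ≤ n := by
  induction n with
  | zero => simp [N.map_zero]
  | succ n ih =>
    rw [Nat.cast_succ]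
    exact (N.map_add_le _ _).trans (Nat.add_le_add ih N.map_one_le)

lemma map_intCast_le (z : ℤ) : N (z : R) ≤ z.natAbs := by
  obtain ⟨n, rfl | rfl⟩ := z.eq_nat_or_neg
  · simpa using N.map_natCast_le n
  · simpa [N.map_neg] using N.map_natCast_le n

lemma map_units_smul (u : ℤˣ) (a : R) : N (u • a) = N a := by
  obtain rfl | rfl := Int.units_eq_one_or u <;> simp [N.map_neg]

/-- The Leibniz expansion has n! terms, each of size at most B ^ n, and n! ≤ n ^ n. -/
lemma map_det_le {n : ℕ} (M : Matrix (Fin n) (Fin n) R) {B : ℕ} (h : ∀ i j, N (M i j) ≤ B) :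
    N M.det ≤ (n * B) ^ n := by
  rw [Matrix.det_apply]
  calc N (∑ σ : Equiv.Perm (Fin n), Equiv.Perm.sign σ • ∏ i, M (σ i) i)
      ≤ ∑ σ : Equiv.Perm (Fin n), N (Equiv.Perm.sign σ • ∏ i, M (σ i) i) := N.map_sum_le _ _
    _ ≤ ∑ _σ : Equiv.Perm (Fin n), B ^ n := by
        refine Finset.sum_le_sum fun σ _ => ?_
        rw [N.map_units_smul]
        refine (N.map_prod_le _ _).trans ?_
        simpa using Finset.prod_le_pow_card Finset.univ (fun i => N (M (σ i) i)) B
          (fun i _ => h _ _)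
    _ = n.factorial * B ^ n := by simp [Fintype.card_perm]
    _ ≤ (n * B) ^ n := by
        rw [mul_pow]
        exact Nat.mul_le_mul_right _ (Nat.factorial_le_pow n)

/-- The absolute value on the integers. -/
def int : LengthFn ℤ where
  toFun := Int.natAbs
  map_zero' := rfl
  map_one_le' := le_rfl
  map_neg' := Int.natAbs_neg
  map_add_le' := Int.natAbs_add_le
  map_mul_le' a b := (Int.natAbs_mul a b).le

open Polynomial

lemma sum_support_eq (p : R[X]) (s : Finset ℕ) (hs : p.support ⊆ s) :
    (∑ i ∈ p.support, N (p.coeff i)) = ∑ i ∈ s, N (p.coeff i) :=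
  Finset.sum_subset hs fun i _ hi => by rw [notMem_support_iff.mp hi, N.map_zero]

lemma sum_support_add_le (p q : R[X]) : (∑ i ∈ (p + q).support, N ((p + q).coeff i)) ≤
    (∑ i ∈ p.support, N (p.coeff i)) + ∑ i ∈ q.support, N (q.coeff i) := by
  rw [N.sum_support_eq (p + q) _ support_add, N.sum_support_eq p _ Finset.subset_union_left,
    N.sum_support_eq q _ Finset.subset_union_right, ← Finset.sum_add_distrib]
  exact Finset.sum_le_sum fun i _ => by rw [coeff_add]; exact N.map_add_le _ _

lemma sum_support_monomial (n : ℕ) (a : R) :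
    (∑ i ∈ (monomial n a).support, N ((monomial n a).coeff i)) = N a := by
  rw [N.sum_support_eq _ _ (support_monomial_subset n a)]
  simp

/-- The sum of the lengths of the coefficients of a polynomial. -/
noncomputable def poly : LengthFn R[X] where
  toFun p := ∑ i ∈ p.support, N (p.coeff i)
  map_zero' := by simp
  map_one_le' := by
    rw [← monomial_zero_one, N.sum_support_monomial]
    exact N.map_one_le
  map_neg' p := by simp [support_neg, N.map_neg]
  map_add_le' p q := N.sum_support_add_le p q
  map_mul_le' p q := by
    have key : ∀ {ι : Type} (s : Finset ι) (g : ι → R[X]),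
        (∑ i ∈ (∑ j ∈ s, g j).support, N ((∑ j ∈ s, g j).coeff i)) ≤
          ∑ j ∈ s, ∑ i ∈ (g j).support, N ((g j).coeff i) := fun s g =>
      Finset.le_sum_of_subadditive (fun p : R[X] => ∑ i ∈ p.support, N (p.coeff i))
        (by simp) N.sum_support_add_le s g
    have e : p * q = ∑ x ∈ p.support ×ˢ q.support,
        monomial (x.1 + x.2) (p.coeff x.1 * q.coeff x.2) := by
      conv_lhs => rw [p.as_sum_support, q.as_sum_support, Finset.sum_mul_sum,
        ← Finset.sum_product']
      exact Finset.sum_congr rfl fun x _ => monomial_mul_monomial _ _ _ _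
    rw [Finset.sum_mul_sum, ← Finset.sum_product', e]
    refine (key _ _).trans (Finset.sum_le_sum fun x _ => ?_)
    rw [N.sum_support_monomial]
    exact N.map_mul_le _ _

lemma poly_monomial (n : ℕ) (a : R) : N.poly (monomial n a) = N a := N.sum_support_monomial n a

lemma poly_C (a : R) : N.poly (C a) = N a := N.poly_monomial 0 a

lemma poly_X_le : N.poly X ≤ 1 := by
  rw [← monomial_one_one_eq_X, N.poly_monomial]
  exact N.map_one_le

lemma coeff_le_poly (p : R[X]) (i : ℕ) : N (p.coeff i) ≤ N.poly p := by
  by_cases hi : i ∈ p.support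
  · exact Finset.single_le_sum (f := fun i => N (p.coeff i)) (fun _ _ => Nat.zero_le _) hi
  · rw [notMem_support_iff.mp hi, N.map_zero]
    exact Nat.zero_le _

end LengthFn

/-! ### Prime divisors of an integer; ranks and minors -/

lemma card_primeFactors_le_of_le_two_pow {m E : ℕ} (hm : m ≠ 0) (h : m ≤ 2 ^ E) :
    m.primeFactors.card ≤ E := by
  have h1 : 2 ^ m.primeFactors.card ≤ ∏ p ∈ m.primeFactors, p :=
    Finset.pow_card_le_prod _ _ _ fun p hp => (Nat.prime_of_mem_primeFactors hp).two_le
  have h2 := Nat.le_of_dvd (Nat.pos_of_ne_zero hm) (Nat.prod_primeFactors_dvd m)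
  exact (Nat.pow_le_pow_iff_right (by norm_num)).mp (h1.trans (h2.trans h))

lemma exists_linearIndependent_row {F m n : Type*} [Field F] [Fintype m] [Fintype n]
    (B : Matrix m n F) {k : ℕ} (hk : B.rank = k) :
    ∃ r : Fin k → m, LinearIndependent F (B.submatrix r id).row := by
  rw [Matrix.rank_eq_finrank_span_row] at hk
  obtain ⟨κ, e, he, hs, hl⟩ := exists_linearIndependent' F B.row
  have : Finite κ := Finite.of_injective e he
  have := Fintype.ofFinite κ
  have hc : Fintype.card κ = k := by
    rw [← hk, ← hs]
    exact (finrank_span_eq_card hl).symm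
  let g := (Fintype.equivFinOfCardEq hc).symm
  exact ⟨e ∘ g, hl.comp g g.injective⟩

/-- Select independent rows as many as the rank, then independent columns of the matrix so obtained.
-/
lemma exists_submatrix_det_ne_zero {F m n : Type*} [Field F] [Fintype m] [Fintype n]
    (A : Matrix m n F) :
    ∃ (r : Fin A.rank → m) (c : Fin A.rank → n), (A.submatrix r c).det ≠ 0 := by
  obtain ⟨r, hr⟩ := exists_linearIndependent_row A rfl
  have h1 : (A.submatrix r id).rank = A.rank := by
    rw [hr.rank_matrix, Fintype.card_fin]
  obtain ⟨c, hc⟩ := exists_linearIndependent_row (A.submatrix r id).transpose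
    (k := A.rank) (by rw [Matrix.rank_transpose, h1])
  refine ⟨r, c, ?_⟩
  have h2 : IsUnit ((A.submatrix r id).transpose.submatrix c id) :=
    Matrix.linearIndependent_rows_iff_isUnit.mp hc
  rw [Matrix.isUnit_iff_isUnit_det] at h2
  rw [← Matrix.det_transpose]
  exact h2.ne_zero

lemma le_rank_of_submatrix_det_ne_zero {F m n : Type*} [Field F] [Fintype m] [Fintype n]
    (A : Matrix m n F) {k : ℕ} (r : Fin k → m) (c : Fin k → n) (h : (A.submatrix r c).det ≠ 0) :
    k ≤ A.rank := by
  have := Matrix.rank_of_isUnit _ ((Matrix.isUnit_iff_isUnit_det _).mpr h.isUnit)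
  rw [Fintype.card_fin] at this
  exact this.symm.le.trans (A.rank_submatrix_le r c)

/-- If a nonzero minor of maximal size survives, then the rank does not change. -/
lemma rank_map_eq {R F₀ F₁ m n : Type*} [CommRing R] [Field F₀] [Field F₁] [Fintype m] [Fintype n]
    (A : Matrix m n R) (φ₀ : R →+* F₀) (φ₁ : R →+* F₁) (h₀ : Function.Injective φ₀)
    (r : Fin (A.map φ₀).rank → m) (c : Fin (A.map φ₀).rank → n)
    (h : φ₁ (A.submatrix r c).det ≠ 0) : (A.map φ₁).rank = (A.map φ₀).rank := by
  refine le_antisymm ?_ (le_rank_of_submatrix_det_ne_zero _ r c ?_)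
  -- A minor that is nonzero under `φ₁` is nonzero in `R`, hence also under the injective `φ₀`: the
  -- rank cannot increase.
  · obtain ⟨r', c', h'⟩ := exists_submatrix_det_ne_zero (A.map φ₁)
    refine le_rank_of_submatrix_det_ne_zero _ r' c' ?_
    rw [Matrix.submatrix_map, ← RingHom.mapMatrix_apply, ← RingHom.map_det] at h' ⊢
    exact (map_ne_zero_iff φ₀ h₀).mpr fun h0 => h' (by rw [h0, map_zero])
  · rwa [Matrix.submatrix_map, ← RingHom.mapMatrix_apply, ← RingHom.map_det]

/-! ### Counting distinct roots by a rank -/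

section DerivMatrix

open Polynomial

/-- The rows are the coefficient vectors of the polynomials `X ^ i * f` and `X ^ i * f'`
for `i < n`. -/
noncomputable def derivMatrix {R : Type*} [CommRing R] (f : R[X]) (n : ℕ) :
    Matrix (Fin n ⊕ Fin n) (Fin (n + n)) R :=
  fun i k => Sum.elim (fun i : Fin n => (X ^ (i : ℕ) * f).coeff k)
    (fun i : Fin n => (X ^ (i : ℕ) * derivative f).coeff k) i

lemma derivMatrix_map {R S : Type*} [CommRing R] [CommRing S] (φ : R →+* S) (f : R[X]) (n : ℕ) :
    (derivMatrix f n).map φ = derivMatrix (f.map φ) n := by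
  ext i k
  obtain i | i := i
  · simp only [derivMatrix, Matrix.map_apply, Sum.elim_inl, ← coeff_map, Polynomial.map_mul,
      Polynomial.map_pow, map_X]
  · simp only [derivMatrix, Matrix.map_apply, Sum.elim_inr, ← coeff_map, Polynomial.map_mul,
      Polynomial.map_pow, map_X, derivative_map]

lemma LengthFn.derivMatrix_le {R : Type*} [CommRing R] (N : LengthFn R) (f : R[X]) (n : ℕ)
    (i : Fin n ⊕ Fin n) (k : Fin (n + n)) :
    N (derivMatrix f n i k) ≤ (n + n) * N.poly f := by
  have hk := k.2
  obtain i | i := i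
  · simp only [derivMatrix, Sum.elim_inl, coeff_X_pow_mul']
    split_ifs
    · exact (N.coeff_le_poly _ _).trans (Nat.le_mul_of_pos_left _ (by omega))
    · rw [N.map_zero]; exact Nat.zero_le _
  · simp only [derivMatrix, Sum.elim_inr, coeff_X_pow_mul', coeff_derivative]
    split_ifs
    · refine (N.map_mul_le _ _).trans ?_
      rw [mul_comm]
      refine Nat.mul_le_mul ?_ (N.coeff_le_poly _ _)
      rw [← Nat.cast_add_one]
      exact (N.map_natCast_le _).trans (by omega)
    · rw [N.map_zero]; exact Nat.zero_le _

variable {F : Type*} [Field F]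

/-- The polynomial of degree less than `n` with the given coefficients. -/
noncomputable def ofCoeffs (n : ℕ) : (Fin n → F) →ₗ[F] F[X] :=
  (degreeLT F n).subtype ∘ₗ (degreeLTEquiv F n).symm.toLinearMap

lemma ofCoeffs_apply {n : ℕ} (w : Fin n → F) :
    ofCoeffs n w = ∑ i : Fin n, monomial (i : ℕ) (w i) := rfl

lemma degree_ofCoeffs_lt {n : ℕ} (w : Fin n → F) : (ofCoeffs n w).degree < n :=
  mem_degreeLT.mp ((degreeLTEquiv F n).symm w).2

lemma ofCoeffs_injective (n : ℕ) : Function.Injective (ofCoeffs (F := F) n) :=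
  Subtype.val_injective.comp (degreeLTEquiv F n).symm.injective

lemma exists_ofCoeffs_eq {n : ℕ} {p : F[X]} (hp : p.degree < n) : ∃ w, ofCoeffs n w = p :=
  ⟨degreeLTEquiv F n ⟨p, mem_degreeLT.mpr hp⟩, by simp [ofCoeffs]⟩

/-- Identifies the left kernel of the matrix with the relations u f + w f' = 0 where u and w have
degree less than n. -/
lemma transpose_derivMatrix_mulVec (f : F[X]) (n : ℕ) (v : Fin n ⊕ Fin n → F) (k : Fin (n + n)) :
    (derivMatrix f n).transpose.mulVec v k =
      (ofCoeffs n (v ∘ Sum.inl) * f + ofCoeffs n (v ∘ Sum.inr) * derivative f).coeff k := by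
  rw [Matrix.mulVec, dotProduct, Fintype.sum_sum_type, coeff_add, ofCoeffs_apply, ofCoeffs_apply,
    Finset.sum_mul, Finset.sum_mul, finsetSum_coeff, finsetSum_coeff]
  congr 1 <;> refine Finset.sum_congr rfl fun i _ => ?_ <;>
    rw [← C_mul_X_pow_eq_monomial, mul_assoc, coeff_C_mul, mul_comm] <;> rfl

/-- If `f` splits over a field of zero or large characteristic, then `f ∣ w f'` if and only if
`w` vanishes at the roots of `f`. -/
lemma dvd_mul_derivative_iff {f : F[X]} (hf : f.Splits) (hf0 : f ≠ 0)
    (hchar : ∀ k : ℕ, 0 < k → k ≤ f.natDegree → (k : F) ≠ 0) (w : F[X]) :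
    f ∣ w * derivative f ↔ ∀ a ∈ f.roots, w.eval a = 0 := by
  classical
  by_cases hw : w = 0
  · simp [hw]
  by_cases hn : f.natDegree = 0
  · have hu : IsUnit f := isUnit_iff_degree_eq_zero.mpr (by rw [degree_eq_natDegree hf0, hn]; rfl)
    obtain ⟨c, rfl⟩ := natDegree_eq_zero.mp hn
    simp [hu.dvd]
  have hd0 : derivative f ≠ 0 := by
    intro h
    have h1 := congrArg (fun p => p.coeff (f.natDegree - 1)) h
    simp only [coeff_derivative, coeff_zero] at h1
    rw [← Nat.cast_add_one, Nat.sub_add_cancel (Nat.pos_of_ne_zero hn)] at h1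
    rcases mul_eq_zero.mp h1 with h1 | h1
    · exact hf0 (leadingCoeff_eq_zero.mp h1)
    · exact hchar _ (Nat.pos_of_ne_zero hn) le_rfl h1
  have hwd : w * derivative f ≠ 0 := mul_ne_zero hw hd0
  rw [hf.dvd_iff_roots_le_roots hf0 hwd, Multiset.le_iff_count]
  simp only [count_roots]
  refine forall_congr' fun a => ?_
  by_cases ha : f.IsRoot a
  · have hpos := (rootMultiplicity_pos hf0).mpr ha
    have hle : f.rootMultiplicity a ≤ f.natDegree := by
      rw [← count_roots]
      exact (Multiset.count_le_card _ _).trans (card_roots' f)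
    -- The multiplicity of a root drops by exactly one in f', so w has to supply the missing factor.
    rw [rootMultiplicity_mul hwd, derivative_rootMultiplicity_of_root_of_mem_nonZeroDivisors ha
      (mem_nonZeroDivisors_of_ne_zero (hchar _ hpos hle))]
    have h1 : 0 < w.rootMultiplicity a ↔ w.eval a = 0 := rootMultiplicity_pos hw
    rw [← h1]
    simp only [mem_roots hf0, ha, true_imp_iff]
    omega
  · rw [rootMultiplicity_eq_zero ha]
    exact ⟨fun _ h => absurd ((mem_roots hf0).mp h) ha, fun _ => Nat.zero_le _⟩

/-- The rank of `derivMatrix` counts the distinct roots. -/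
lemma rank_derivMatrix [DecidableEq F] {f : F[X]} (hf : f.Splits) (hf0 : f ≠ 0)
    (hchar : ∀ k : ℕ, 0 < k → k ≤ f.natDegree → (k : F) ≠ 0) :
    (derivMatrix f f.natDegree).rank = f.natDegree + f.roots.toFinset.card := by
  set n := f.natDegree with hn
  set A := derivMatrix f n
  have hcard : f.roots.toFinset.card ≤ n := (Multiset.toFinset_card_le _).trans (card_roots' f)
  -- Evaluation at the distinct roots. It is onto by Lagrange interpolation, so its kernel has
  -- dimension n minus the number of roots.
  let E : (Fin n → F) →ₗ[F] (f.roots.toFinset → F) :=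
    LinearMap.pi fun a => (leval (a : F)) ∘ₗ ofCoeffs n
  have hE : Function.Surjective E := by
    intro g
    let g' : F → F := fun a => if h : a ∈ f.roots.toFinset then g ⟨a, h⟩ else 0
    have hinj : Set.InjOn (id : F → F) (f.roots.toFinset : Set F) := Function.injective_id.injOn
    obtain ⟨w, hw⟩ := exists_ofCoeffs_eq (n := n)
      ((Lagrange.degree_interpolate_lt g' hinj).trans_le (by exact_mod_cast hcard))
    refine ⟨w, funext fun a => ?_⟩
    have h1 := Lagrange.eval_interpolate_at_node g' hinj a.2
    simp only [E, LinearMap.pi_apply, LinearMap.comp_apply, hw, leval_apply]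
    exact h1.trans (dif_pos a.2)
  have hEr := E.finrank_range_add_finrank_ker
  rw [LinearMap.range_eq_top.mpr hE, finrank_top, Module.finrank_fintype_fun_eq_card,
    Module.finrank_fintype_fun_eq_card, Fintype.card_coe, Fintype.card_fin] at hEr
  have hker : ∀ v, v ∈ LinearMap.ker A.transpose.mulVecLin ↔
      ofCoeffs n (v ∘ Sum.inl) * f + ofCoeffs n (v ∘ Sum.inr) * derivative f = 0 := by
    intro v
    rw [LinearMap.mem_ker, Matrix.mulVecLin_apply]
    constructor
    · intro h
      have hdeg : ∀ (w : Fin n → F) (g : F[X]), g.natDegree ≤ n →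
          (ofCoeffs n w * g).degree < (n + n : ℕ) := by
        intro w g hg
        by_cases hg0 : g = 0
        · rw [hg0, mul_zero, degree_zero]; exact WithBot.bot_lt_coe _
        rw [degree_mul, Nat.cast_add]
        exact WithBot.add_lt_add_of_lt_of_le (by simpa using hg0) (degree_ofCoeffs_lt w)
          (natDegree_le_iff_degree_le.mp hg)
      ext k
      by_cases hk : k < n + n
      · have := congrFun h ⟨k, hk⟩
        rwa [transpose_derivMatrix_mulVec] at this
      · refine coeff_eq_zero_of_degree_lt ((degree_add_le _ _).trans_lt (max_lt ?_ ?_)) <;>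
          refine lt_of_lt_of_le (hdeg _ _ ?_) (by exact_mod_cast not_lt.mp hk)
        · exact le_rfl
        · exact (natDegree_derivative_le f).trans (Nat.sub_le _ _)
    · intro h
      funext k
      rw [transpose_derivMatrix_mulVec, h]
      simp
  -- Send a relation u f + w f' = 0 to w. As f ≠ 0, w determines u; the image consists of the w with
  -- f ∣ w f', which is the kernel of `E`.
  let κ : LinearMap.ker A.transpose.mulVecLin →ₗ[F] (Fin n → F) :=
    (LinearMap.funLeft F F Sum.inr) ∘ₗ (LinearMap.ker A.transpose.mulVecLin).subtype
  have hκ : Function.Injective κ := by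
    rw [← LinearMap.ker_eq_bot, LinearMap.ker_eq_bot']
    rintro ⟨v, hv⟩ h
    have h1 : v ∘ Sum.inr = 0 := h
    have h2 := (hker v).mp hv
    rw [h1, _root_.map_zero, zero_mul, add_zero, mul_eq_zero, or_iff_left hf0] at h2
    have h3 : v ∘ Sum.inl = 0 := ofCoeffs_injective n (by rw [h2, _root_.map_zero])
    refine Subtype.ext (funext fun i => ?_)
    obtain i | i := i
    · exact congrFun h3 i
    · exact congrFun h1 i
  have hrange : LinearMap.range κ = LinearMap.ker E := by
    ext w
    have hEw : w ∈ LinearMap.ker E ↔ f ∣ ofCoeffs n w * derivative f := by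
      rw [dvd_mul_derivative_iff hf hf0 hchar, LinearMap.mem_ker, funext_iff]
      simp [E, Subtype.forall]
    rw [hEw, LinearMap.mem_range]
    constructor
    · rintro ⟨⟨v, hv⟩, rfl⟩
      have h2 := (hker v).mp hv
      exact ⟨-ofCoeffs n (v ∘ Sum.inl), by
        have : κ ⟨v, hv⟩ = v ∘ Sum.inr := rfl
        rw [this]; linear_combination h2⟩
    · rintro ⟨u, hu⟩
      have hud : (-u).degree < n := by
        rw [degree_neg]
        by_cases hu0 : u = 0
        · rw [hu0, degree_zero]; exact WithBot.bot_lt_coe _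
        have hp0 : ofCoeffs n w * derivative f ≠ 0 := by rw [hu]; exact mul_ne_zero hf0 hu0
        -- The cofactor u has degree less than n because deg (w f') < n + deg f.
        have h1 := natDegree_lt_natDegree hp0 (p := ofCoeffs n w * derivative f)
          (q := X ^ n * f) (by
            rw [degree_mul, degree_mul, degree_X_pow]
            refine WithBot.add_lt_add_of_lt_of_le ?_ (degree_ofCoeffs_lt w)
              (degree_derivative_le)
            simpa using right_ne_zero_of_mul hp0)
        rw [hu, natDegree_mul hf0 hu0, natDegree_mul (pow_ne_zero _ X_ne_zero) hf0,
          natDegree_X_pow] at h1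
        rw [← natDegree_lt_iff_degree_lt hu0]
        omega
      obtain ⟨u', hu'⟩ := exists_ofCoeffs_eq hud
      refine ⟨⟨Sum.elim u' w, (hker _).mpr ?_⟩, rfl⟩
      rw [Sum.elim_comp_inl, Sum.elim_comp_inr, hu', hu]
      ring
  have h1 : Module.finrank F (LinearMap.ker A.transpose.mulVecLin) =
      Module.finrank F (LinearMap.ker E) := by
    rw [← hrange, LinearMap.finrank_range_of_inj hκ]
  have h2 := A.transpose.mulVecLin.finrank_range_add_finrank_ker
  rw [Module.finrank_fintype_fun_eq_card, Fintype.card_sum, Fintype.card_fin, h1] at h2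
  rw [← Matrix.rank_transpose, Matrix.rank]
  omega

end DerivMatrix

/-! ### The sheared resultant and the common zeros -/

section Shear

open MvPolynomial

variable {R S : Type*} [CommRing R] [CommRing S]

/-- The polynomial `P(t - s Y, Y)` in `Y`. -/
noncomputable def shearAt (t s : R) (P : MvPolynomial (Fin 2) ℤ) : Polynomial R :=
  aeval ![Polynomial.C t - Polynomial.C s * Polynomial.X, Polynomial.X] P

lemma shear_eq_shearAt (P : MvPolynomial (Fin 2) ℤ) : shear P = shearAt (X 0) (X 1) P := rfl

lemma map_shearAt (φ : R →+* S) (t s : R) (P : MvPolynomial (Fin 2) ℤ) :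
    (shearAt t s P).map φ = shearAt (φ t) (φ s) P := by
  rw [shearAt, ← Polynomial.coe_mapRingHom, map_aeval, shearAt, aeval_def,
    ← coe_eval₂Hom]
  refine congrFun (congrArg _ (congrArg₂ eval₂Hom (RingHom.ext_int _ _) ?_)) P
  funext i
  fin_cases i <;> simp

lemma hom_shearAt (ψ : Polynomial R →+* S) (t s : R) (P : MvPolynomial (Fin 2) ℤ) :
    ψ (shearAt t s P) = eval₂Hom (Int.castRingHom S)
      ![ψ (Polynomial.C t) - ψ (Polynomial.C s) * ψ Polynomial.X, ψ Polynomial.X] P := by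
  rw [shearAt, map_aeval]
  refine congrFun (congrArg _ (congrArg₂ eval₂Hom (RingHom.ext_int _ _) ?_)) P
  funext i
  fin_cases i <;> simp

lemma eval_shearAt (t s y : R) (P : MvPolynomial (Fin 2) ℤ) :
    (shearAt t s P).eval y = aeval ![t - s * y, y] P := by
  rw [← Polynomial.coe_evalRingHom, hom_shearAt, aeval_def, ← coe_eval₂Hom]
  refine congrFun (congrArg _ (congrArg₂ eval₂Hom (RingHom.ext_int _ _) ?_)) P
  simp

lemma shearAt_eq_sum (t s : R) (P : MvPolynomial (Fin 2) ℤ) :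
    shearAt t s P = ∑ m ∈ P.support, Polynomial.C ((P.coeff m : ℤ) : R) *
      ((Polynomial.C t - Polynomial.C s * Polynomial.X) ^ m 0 * Polynomial.X ^ m 1) := by
  rw [shearAt, aeval_def, eval₂_eq']
  refine Finset.sum_congr rfl fun m _ => ?_
  simp [Fin.prod_univ_two]

lemma natDegree_linear_le (t s : R) :
    (Polynomial.C t - Polynomial.C s * Polynomial.X).natDegree ≤ 1 := by
  compute_degree

lemma natDegree_linear_pow_le (t s : R) (n : ℕ) :
    ((Polynomial.C t - Polynomial.C s * Polynomial.X) ^ n).natDegree ≤ n := by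
  simpa using Polynomial.natDegree_pow_le_of_le n (natDegree_linear_le t s)

lemma add_le_totalDegree {P : MvPolynomial (Fin 2) ℤ} {m : Fin 2 →₀ ℕ} (hm : m ∈ P.support) :
    m 0 + m 1 ≤ P.totalDegree := by
  have := le_totalDegree hm
  rwa [Finsupp.sum_fintype _ _ (fun _ => rfl), Fin.sum_univ_two] at this

lemma natDegree_shearAt_le (t s : R) (P : MvPolynomial (Fin 2) ℤ) :
    (shearAt t s P).natDegree ≤ P.totalDegree := by
  rw [shearAt_eq_sum]
  refine Polynomial.natDegree_sum_le_of_forall_le _ _ fun m hm => ?_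
  refine (Polynomial.natDegree_C_mul_le _ _).trans (Polynomial.natDegree_mul_le.trans ?_)
  exact (Nat.add_le_add (natDegree_linear_pow_le t s _) (Polynomial.natDegree_X_pow_le _)).trans
    (add_le_totalDegree hm)

/-- The polynomial `P_n(-S, 1)`, where `P_n` is the homogeneous part of `P` of top degree. -/
noncomputable def topForm (P : MvPolynomial (Fin 2) ℤ) : Polynomial ℤ :=
  ∑ m ∈ P.support with m 0 + m 1 = P.totalDegree,
    Polynomial.C (P.coeff m) * (-Polynomial.X) ^ m 0

/-- Only the monomials of top degree reach this power of Y, and they do so through the factor (-s) ^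
m 0; hence `t` plays no role. -/
lemma coeff_shearAt_totalDegree (t s : R) (P : MvPolynomial (Fin 2) ℤ) :
    (shearAt t s P).coeff P.totalDegree = Polynomial.aeval s (topForm P) := by
  rw [shearAt_eq_sum, Polynomial.finsetSum_coeff, topForm, map_sum, Finset.sum_filter]
  refine Finset.sum_congr rfl fun m hm => ?_
  rw [Polynomial.coeff_C_mul, Polynomial.coeff_mul_X_pow']
  have h := add_le_totalDegree hm
  rw [if_pos (by omega)]
  split_ifs with h1
  · have h2 : P.totalDegree - m 1 = m 0 * 1 := by omega
    rw [h2, Polynomial.coeff_pow_of_natDegree_le (natDegree_linear_le t s)]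
    simp [Polynomial.coeff_C]
  · rw [Polynomial.coeff_eq_zero_of_natDegree_lt, mul_zero]
    exact (natDegree_linear_pow_le t s _).trans_lt (by omega)

lemma natDegree_shearAt {t s : R} {P : MvPolynomial (Fin 2) ℤ}
    (h : Polynomial.aeval s (topForm P) ≠ 0) : (shearAt t s P).natDegree = P.totalDegree :=
  Polynomial.natDegree_eq_of_le_of_coeff_ne_zero (natDegree_shearAt_le t s P)
    (by rwa [coeff_shearAt_totalDegree])

/-- Among monomials of equal total degree the exponent of X determines the monomial, so nothing
cancels. -/
lemma topForm_ne_zero {P : MvPolynomial (Fin 2) ℤ} (hP : P ≠ 0) : topForm P ≠ 0 := by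
  obtain ⟨m, hm, hd⟩ := Finset.exists_mem_eq_sup P.support (support_nonempty.mpr hP)
    (fun m => m.sum fun _ e => e)
  have hd' : m 0 + m 1 = P.totalDegree := by
    rw [totalDegree, hd, Finsupp.sum_fintype _ _ (fun _ => rfl), Fin.sum_univ_two]
  intro h
  have h1 := congrArg (fun p => p.coeff (m 0)) h
  simp only [topForm, Polynomial.finsetSum_coeff, Polynomial.coeff_zero] at h1
  rw [Finset.sum_eq_single m] at h1
  · rw [neg_pow, ← Polynomial.C_1, ← Polynomial.C_neg, ← Polynomial.C_pow, Polynomial.coeff_C_mul,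
      Polynomial.coeff_C_mul, Polynomial.coeff_X_pow_self, mul_one] at h1
    rcases mul_eq_zero.mp h1 with h1 | h1
    · exact mem_support_iff.mp hm h1
    · exact pow_ne_zero _ (by norm_num) h1
  · intro m' hm' hne
    rw [Finset.mem_filter] at hm'
    have : m' 0 ≠ m 0 := fun h0 => hne <| Finsupp.ext fun i => by
      fin_cases i
      · exact h0
      · show m' 1 = m 1
        omega
    rw [neg_pow, ← Polynomial.C_1, ← Polynomial.C_neg, ← Polynomial.C_pow, Polynomial.coeff_C_mul,
      Polynomial.coeff_C_mul, Polynomial.coeff_X_pow, if_neg this.symm, mul_zero, mul_zero]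
  · intro h2
    exact absurd (Finset.mem_filter.mpr ⟨hm, hd'⟩) h2

/-- The resultant with respect to `Y` of `P(T - S Y, Y)` and `Q(T - S Y, Y)`, as a polynomial in `T`
with coefficients in `ℤ[S]`. -/
noncomputable def shearResultant (P Q : MvPolynomial (Fin 2) ℤ) : Polynomial (Polynomial ℤ) :=
  Polynomial.resultant (shearAt Polynomial.X (Polynomial.C Polynomial.X) P)
    (shearAt Polynomial.X (Polynomial.C Polynomial.X) Q) P.totalDegree Q.totalDegree

/-- The resultant is taken with fixed formal degrees, so it commutes with every specialisation, even
one that lowers a degree. -/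
lemma eval_map_shearResultant (t s : R) (P Q : MvPolynomial (Fin 2) ℤ) :
    ((shearResultant P Q).map (Polynomial.aeval s : Polynomial ℤ →ₐ[ℤ] R).toRingHom).eval t =
      Polynomial.resultant (shearAt t s P) (shearAt t s Q) P.totalDegree Q.totalDegree := by
  rw [Polynomial.eval_map, ← Polynomial.coe_eval₂RingHom, shearResultant,
    ← Polynomial.resultant_map_map, map_shearAt, map_shearAt]
  congr 2
  · exact Polynomial.eval₂_X _ _
  · exact (Polynomial.eval₂_C _ _).trans (Polynomial.aeval_X s)
  · exact Polynomial.eval₂_X _ _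
  · exact (Polynomial.eval₂_C _ _).trans (Polynomial.aeval_X s)

/-- At an `s` where the top forms do not vanish, the roots of the sheared resultant are the values
of `x + s y` at the common zeros. -/
lemma eval_map_shearResultant_eq_zero_iff {F : Type*} [Field F] [IsAlgClosed F] {s : F} (t : F)
    {P Q : MvPolynomial (Fin 2) ℤ} (hP : Polynomial.aeval s (topForm P) ≠ 0)
    (hQ : Polynomial.aeval s (topForm Q) ≠ 0) :
    ((shearResultant P Q).map (Polynomial.aeval s : Polynomial ℤ →ₐ[ℤ] F).toRingHom).eval t = 0 ↔
      ∃ y, aeval ![t - s * y, y] P = 0 ∧ aeval ![t - s * y, y] Q = 0 := by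
  have hP0 : shearAt t s P ≠ 0 := fun h => hP (by
    rw [← coeff_shearAt_totalDegree t, h, Polynomial.coeff_zero])
  rw [eval_map_shearResultant, ← natDegree_shearAt (t := t) hP, ← natDegree_shearAt (t := t) hQ,
    Polynomial.resultant_eq_zero_iff]
  simp only [← eval_shearAt]
  constructor
  · rintro ⟨-, h⟩
    by_contra! h'
    refine h (isCoprime_of_dvd _ _ (fun h0 => hP0 h0.1) fun g hg hg0 hgP hgQ => ?_)
    obtain ⟨y, hy⟩ := IsAlgClosed.exists_root g
      (fun h0 => hg (Polynomial.isUnit_iff_degree_eq_zero.mpr h0))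
    exact h' y (hy.dvd hgP) (hy.dvd hgQ)
  · rintro ⟨y, h1, h2⟩
    refine ⟨Or.inl hP0, fun ⟨u, v, huv⟩ => ?_⟩
    have := congrArg (Polynomial.eval y) huv
    simp [h1, h2] at this

/-- If `s` is not in `K`, then the common zeros over `K` are counted by the sheared resultant. -/
lemma encard_zeros {K F : Type*} [Field K] [IsAlgClosed K] [Field F] [IsAlgClosed F]
    [DecidableEq F] [Algebra K F] {s : F} (hs : s ∉ Set.range (algebraMap K F))
    {P Q : MvPolynomial (Fin 2) ℤ} (hP : Polynomial.aeval s (topForm P) ≠ 0)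
    (hQ : Polynomial.aeval s (topForm Q) ≠ 0)
    (hf : (shearResultant P Q).map (Polynomial.aeval s : Polynomial ℤ →ₐ[ℤ] F).toRingHom ≠ 0) :
    {x : Fin 2 → K | aeval x P = 0 ∧ aeval x Q = 0}.encard =
      (((shearResultant P Q).map
        (Polynomial.aeval s : Polynomial ℤ →ₐ[ℤ] F).toRingHom).roots.toFinset.card : ℕ∞) := by
  have hinj := (algebraMap K F).injective
  have hae : ∀ (x : Fin 2 → K) (G : MvPolynomial (Fin 2) ℤ),
      aeval (fun i => algebraMap K F (x i)) G = algebraMap K F (aeval x G) := fun x G => by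
    rw [map_aeval, aeval_def, ← coe_eval₂Hom]
    exact congrFun (congrArg _ (congrArg₂ eval₂Hom (RingHom.ext_int _ _) rfl)) G
  rw [← Set.encard_coe_eq_coe_finsetCard]
  let e : (Fin 2 → K) → F := fun x => algebraMap K F (x 0) + s * algebraMap K F (x 1)
  have he : Function.Injective e := by
    intro x x' h
    have h : algebraMap K F (x 0) + s * algebraMap K F (x 1) =
      algebraMap K F (x' 0) + s * algebraMap K F (x' 1) := h
    have h1 : x 1 = x' 1 := by
      by_contra hne
      -- Two points with the same value of x + s y and distinct y would express s as a slope in `K`.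
      refine hs ⟨(x' 0 - x 0) / (x 1 - x' 1), ?_⟩
      have hne' : algebraMap K F (x 1) - algebraMap K F (x' 1) ≠ 0 := by
        rw [← map_sub]
        exact (map_ne_zero_iff _ hinj).mpr (sub_ne_zero.mpr hne)
      rw [map_div₀, map_sub, map_sub, div_eq_iff hne']
      linear_combination -h
    have h0 : x 0 = x' 0 := by
      rw [h1] at h
      exact hinj (add_right_cancel h)
    funext i
    fin_cases i
    · exact h0
    · exact h1
  rw [← he.encard_image]
  congr 1
  ext t
  rw [Finset.mem_coe, Multiset.mem_toFinset, Polynomial.mem_roots hf, Polynomial.IsRoot,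
    eval_map_shearResultant_eq_zero_iff t hP hQ]
  constructor
  · rintro ⟨x, ⟨h1, h2⟩, rfl⟩
    have hx : ![e x - s * algebraMap K F (x 1), algebraMap K F (x 1)] =
        fun i => algebraMap K F (x i) := by
      funext i
      fin_cases i <;> simp [e]
    exact ⟨algebraMap K F (x 1), by rw [hx, hae, h1, map_zero], by rw [hx, hae, h2, map_zero]⟩
  · rintro ⟨y, h1, h2⟩
    -- It remains to see that a common zero over `F` has coordinates in `K`. The polynomial `g`
    -- excludes the finitely many shears c in `K` at which a top form or this coefficient vanishes.
    obtain ⟨i, hi⟩ : ∃ i, Polynomial.aeval s ((shearResultant P Q).coeff i) ≠ 0 := by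
      by_contra! h
      exact hf (Polynomial.ext fun i => by rw [Polynomial.coeff_map]; simpa using h i)
    set a := (shearResultant P Q).coeff i
    set g : Polynomial ℤ := topForm P * topForm Q * a
    have hg : g.map (Int.castRingHom K) ≠ 0 := by
      intro h
      have h3 : Polynomial.aeval s g = 0 := by
        have := congrArg (Polynomial.eval₂ (algebraMap K F) s) h
        rw [Polynomial.eval₂_map, Polynomial.eval₂_zero] at this
        rw [Polynomial.aeval_def, ← this]
        exact congrArg (fun φ => Polynomial.eval₂ φ s g) (RingHom.ext_int _ _)
      rw [map_mul, map_mul] at h3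
      exact mul_ne_zero (mul_ne_zero hP hQ) hi h3
    have haes : ∀ (c : K) (p : Polynomial ℤ), Polynomial.aeval (algebraMap K F c) p =
        algebraMap K F ((p.map (Int.castRingHom K)).eval c) := fun c p => by
      rw [← Polynomial.eval₂_at_apply, Polynomial.eval₂_map, Polynomial.aeval_def]
      exact congrArg (fun φ => Polynomial.eval₂ φ _ p) (RingHom.ext_int _ _)
    -- For a good c in `K`, x + c y is a root of a nonzero polynomial over the algebraically closed
    -- `K`, hence lies in `K`. Two such values of c determine x and y.
    have key : ∀ c : K, (g.map (Int.castRingHom K)).eval c ≠ 0 →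
        ∃ b : K, (t - s * y) + algebraMap K F c * y = algebraMap K F b := by
      intro c hc
      have hc' : Polynomial.aeval (algebraMap K F c) g ≠ 0 := by
        rw [haes]; exact (map_ne_zero_iff _ hinj).mpr hc
      rw [map_mul, map_mul] at hc'
      have hr := (eval_map_shearResultant_eq_zero_iff ((t - s * y) + algebraMap K F c * y)
        (left_ne_zero_of_mul (left_ne_zero_of_mul hc'))
        (right_ne_zero_of_mul (left_ne_zero_of_mul hc'))).mpr
          ⟨y, by simpa using h1, by simpa using h2⟩
      have hm : (shearResultant P Q).map
          (Polynomial.aeval (algebraMap K F c) : Polynomial ℤ →ₐ[ℤ] F).toRingHom =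
          ((shearResultant P Q).map
            (Polynomial.aeval c : Polynomial ℤ →ₐ[ℤ] K).toRingHom).map (algebraMap K F) := by
        rw [Polynomial.map_map]
        refine congrArg (fun φ => (shearResultant P Q).map φ) (Polynomial.ringHom_ext ?_ ?_) <;>
          simp
      rw [hm] at hr
      have hne : (shearResultant P Q).map
          (Polynomial.aeval c : Polynomial ℤ →ₐ[ℤ] K).toRingHom ≠ 0 := by
        intro h0
        have h3 := congrArg (fun p => p.coeff i) h0
        simp only [Polynomial.coeff_map, Polynomial.coeff_zero] at h3
        refine right_ne_zero_of_mul hc' ?_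
        rw [haes]
        have h4 : (a.map (Int.castRingHom K)).eval c = Polynomial.aeval c a := by
          rw [Polynomial.eval_map, Polynomial.aeval_def]
          exact congrArg (fun φ => Polynomial.eval₂ φ _ a) (RingHom.ext_int _ _)
        rw [h4, show Polynomial.aeval c a = 0 from h3, map_zero]
      have hmem := (Polynomial.mem_roots ((Polynomial.map_ne_zero_iff hinj).mpr hne)).mpr hr
      rw [(IsAlgClosed.splits _).roots_map, Multiset.mem_map] at hmem
      obtain ⟨b, -, hb⟩ := hmem
      exact ⟨b, hb.symm⟩
    obtain ⟨c, hc⟩ := Polynomial.exists_eval_ne_zero_of_natDegree_lt_card _ hg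
      ((Cardinal.natCast_lt_aleph0).trans_le (Cardinal.infinite_iff.mp IsAlgClosed.instInfinite))
    obtain ⟨c', hc'⟩ := Polynomial.exists_eval_ne_zero_of_natDegree_lt_card _
      (mul_ne_zero hg (Polynomial.X_sub_C_ne_zero c))
      ((Cardinal.natCast_lt_aleph0).trans_le (Cardinal.infinite_iff.mp IsAlgClosed.instInfinite))
    rw [Polynomial.eval_mul, Polynomial.eval_sub, Polynomial.eval_X, Polynomial.eval_C] at hc'
    have hcc := right_ne_zero_of_mul hc'
    obtain ⟨b, hb⟩ := key c hc
    obtain ⟨b', hb'⟩ := key c' (left_ne_zero_of_mul hc')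
    have hcc' : algebraMap K F c' - algebraMap K F c ≠ 0 := by
      rw [← map_sub]
      exact (map_ne_zero_iff _ hinj).mpr hcc
    have hy : y = algebraMap K F ((b' - b) / (c' - c)) := by
      rw [map_div₀, map_sub, map_sub, eq_div_iff hcc']
      linear_combination hb' - hb
    set z := (b' - b) / (c' - c)
    have hx : t - s * y = algebraMap K F (b - c * z) := by
      rw [map_sub, map_mul, ← hy]
      linear_combination hb
    have hv : ![t - s * y, y] = fun i => algebraMap K F (![b - c * z, z] i) := by
      funext i
      fin_cases i
      · exact hx
      · exact hy
    rw [hv, hae] at h1 h2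
    refine ⟨![b - c * z, z], ⟨hinj (by rw [h1, map_zero]), hinj (by rw [h2, map_zero])⟩, ?_⟩
    have : e ![b - c * z, z] = algebraMap K F (b - c * z) + s * algebraMap K F z := rfl
    rw [this, ← hx, ← hy]
    ring

end Shear

/-! ### Nonvanishing of the resultant -/

section Resultant

open Polynomial

/-- A kernel vector of the Sylvester matrix is a relation f a + g b = 0 with deg b < deg f.
Coprimality gives f ∣ b, so b = 0 and then a = 0. -/
lemma resultant_ne_zero_of_isRelPrime {R : Type*} [CommRing R] [IsDomain R]
    [UniqueFactorizationMonoid R] {f g : R[X]} (hf : f ≠ 0) (h : IsRelPrime f g) :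
    resultant f g f.natDegree g.natDegree ≠ 0 := by
  intro h0
  obtain ⟨v, hv0, hv⟩ := Matrix.exists_mulVec_eq_zero_iff.mpr h0
  let b₁ := ((degreeLT.basis R f.natDegree).prod (degreeLT.basis R g.natDegree)).reindex
    finSumFinEquiv
  set x := b₁.equivFun.symm v with hx
  have hxv : (b₁.repr x : _ → R) = v := by
    rw [← Module.Basis.equivFun_apply, hx, LinearEquiv.apply_symm_apply]
  have h1 := LinearMap.toMatrix_mulVec_repr b₁ (degreeLT.basis R (f.natDegree + g.natDegree))
    (sylvesterMap f g le_rfl le_rfl) x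
  rw [toMatrix_sylvesterMap', hxv, hv] at h1
  have h2 : sylvesterMap f g le_rfl le_rfl x = 0 := by
    rw [← (degreeLT.basis R (f.natDegree + g.natDegree)).repr.map_eq_zero_iff]
    exact Finsupp.ext fun i => (congrFun h1 i).symm
  have h3 : f * (x.2 : R[X]) + g * (x.1 : R[X]) = 0 := congrArg Subtype.val h2
  have h4 : f ∣ (x.1 : R[X]) := by
    refine h.dvd_of_dvd_mul_left ?_
    exact ⟨-x.2, by linear_combination h3⟩
  have h5 : (x.1 : R[X]) = 0 := by
    refine eq_zero_of_dvd_of_degree_lt h4 ?_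
    rw [degree_eq_natDegree hf]
    exact mem_degreeLT.mp x.1.2
  rw [h5, mul_zero, add_zero, mul_eq_zero, or_iff_right hf] at h3
  have h6 : x = 0 := Prod.ext (Subtype.ext h5) (Subtype.ext h3)
  exact hv0 (by rw [← hxv, h6]; simp)

/-- The substitution T ↦ X + S Y undoes the shear. It carries a common divisor to a divisor of the
constants P and Q in ℤ[X, Y][S], that is, to a common divisor of P and Q themselves; `ρ` brings the
resulting unit back. -/
lemma isRelPrime_shearAt {P Q : MvPolynomial (Fin 2) ℤ} (h : IsRelPrime P Q) :
    IsRelPrime (shearAt (X : ℤ[X][X]) (C X) P) (shearAt X (C X) Q) := by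
  let θ : ℤ[X][X][X] →+* (MvPolynomial (Fin 2) ℤ)[X] :=
    eval₂RingHom (eval₂RingHom (eval₂RingHom (Int.castRingHom _) X)
      (C (MvPolynomial.X 0) + X * C (MvPolynomial.X 1))) (C (MvPolynomial.X 1))
  let ρ₀ : MvPolynomial (Fin 2) ℤ →+* ℤ[X][X][X] :=
    (MvPolynomial.aeval (R := ℤ) (S₁ := ℤ[X][X][X]) ![C X - C (C X) * X, X]).toRingHom
  let ρ : (MvPolynomial (Fin 2) ℤ)[X] →+* ℤ[X][X][X] :=
    eval₂RingHom (S := ℤ[X][X][X]) ρ₀ (C (C X))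
  have hρθ : ρ.comp θ = RingHom.id _ := by
    refine ringHom_ext' (ringHom_ext' (ringHom_ext' (RingHom.ext_int _ _) ?_) ?_) ?_
    · simp [θ, ρ]
    · simp only [θ, ρ, ρ₀, RingHom.comp_apply, coe_eval₂RingHom, eval₂_C, eval₂_X, eval₂_add,
        eval₂_mul, RingHom.id_apply]
      simp
      exact sub_add_cancel (C X : ℤ[X][X][X]) (C (C X) * X)
    · simp [θ, ρ, ρ₀]
  have hθ : ∀ G : MvPolynomial (Fin 2) ℤ, θ (shearAt X (C X) G) = C G := by
    intro G
    rw [hom_shearAt]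
    refine congrFun (congrArg _ (MvPolynomial.ringHom_ext (fun r => ?_) fun i => ?_ :
      MvPolynomial.eval₂Hom _ _ = (C : MvPolynomial (Fin 2) ℤ →+* _))) G
    · simp
    · fin_cases i <;> simp [θ]
  intro g hgP hgQ
  have h1 := map_dvd θ hgP
  have h2 := map_dvd θ hgQ
  rw [hθ] at h1 h2
  have hC : ∀ {a b : MvPolynomial (Fin 2) ℤ}, C a ∣ C b → a ∣ b := fun {a b} hab => by
    simpa using (C_dvd_iff_dvd_coeff a (C b)).mp hab 0
  by_cases hg : θ g = 0
  · rw [hg, zero_dvd_iff, C_eq_zero] at h1 h2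
    rw [h1, h2] at h
    exact absurd (h dvd_rfl dvd_rfl) not_isUnit_zero
  have hunit : IsUnit (θ g) := by
    by_cases hP : P = 0
    · by_cases hQ : Q = 0
      · rw [hP, hQ] at h
        exact absurd (h dvd_rfl dvd_rfl) not_isUnit_zero
      · have hd : (θ g).natDegree = 0 := by
          simpa using natDegree_le_of_dvd h2 (C_ne_zero.mpr hQ)
        rw [eq_C_of_natDegree_eq_zero hd] at h1 h2 ⊢
        exact (h (hC h1) (hC h2)).map C
    · have hd : (θ g).natDegree = 0 := by
        simpa using natDegree_le_of_dvd h1 (C_ne_zero.mpr hP)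
      rw [eq_C_of_natDegree_eq_zero hd] at h1 h2 ⊢
      exact (h (hC h1) (hC h2)).map C
  have := hunit.map ρ
  rwa [← RingHom.comp_apply, hρθ] at this

lemma shearResultant_ne_zero {P Q : MvPolynomial (Fin 2) ℤ} (hP : P ≠ 0) (hQ : Q ≠ 0)
    (h : IsRelPrime P Q) : shearResultant P Q ≠ 0 := by
  have key : ∀ G : MvPolynomial (Fin 2) ℤ, G ≠ 0 →
      aeval (C X : ℤ[X][X]) (topForm G) ≠ 0 := by
    intro G hG h0
    refine topForm_ne_zero hG ?_
    have h1 : aeval (C X : ℤ[X][X]) (topForm G) = C (topForm G) := by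
      rw [← algebraMap_eq, aeval_algebraMap_apply, aeval_X_left_apply]
    rwa [h1, C_eq_zero] at h0
  have hP' := natDegree_shearAt (t := X) (key P hP)
  have hQ' := natDegree_shearAt (t := X) (key Q hQ)
  rw [shearResultant, ← hP', ← hQ']
  refine resultant_ne_zero_of_isRelPrime (fun h0 => key P hP ?_) (isRelPrime_shearAt h)
  exact (coeff_shearAt_totalDegree (R := ℤ[X][X]) X (C X) P).symm.trans (by rw [h0, coeff_zero])

end Resultant

/-! ### Bounds on sizes and degrees -/

section Bounds

open Polynomial

lemma natAbs_coeff_le_of_bitsize_le {P : MvPolynomial (Fin 2) ℤ} {τ : ℕ} (h : bitsize P ≤ τ)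
    {m : Fin 2 →₀ ℕ} (hm : m ∈ P.support) : (P.coeff m).natAbs ≤ 2 ^ τ := by
  have h1 : intBitsize (P.coeff m) ≤ τ :=
    (Finset.le_sup (f := fun m => intBitsize (P.coeff m)) hm).trans h
  exact (Nat.lt_pow_succ_log_self (by norm_num) _).le.trans (Nat.pow_le_pow_right (by norm_num) h1)

lemma card_support_le (P : MvPolynomial (Fin 2) ℤ) : P.support.card ≤ (P.totalDegree + 1) ^ 2 := by
  have h := Finset.card_le_card_of_injOn (s := P.support)
    (t := Finset.range (P.totalDegree + 1) ×ˢ Finset.range (P.totalDegree + 1))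
    (fun m => (m 0, m 1)) (fun m hm => by
      have := add_le_totalDegree hm
      simp only [Finset.coe_product, Set.mem_prod, Finset.mem_coe, Finset.mem_range]
      omega) (fun m _ m' _ hmm => by
      obtain ⟨h0, h1⟩ := Prod.mk.inj hmm
      exact Finsupp.ext fun i => by
        fin_cases i
        · exact h0
        · exact h1)
  rwa [Finset.card_product, Finset.card_range, ← sq] at h

/-- There are at most (d + 1)² ≤ 2^(2d) terms, each a coefficient of size at most 2^τ times at most
d linear factors of size at most 2. -/
lemma LengthFn.poly_shearAt_le {R : Type*} [CommRing R] (N : LengthFn R) {t s : R}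
    (ht : N t ≤ 1) (hs : N s ≤ 1) {P : MvPolynomial (Fin 2) ℤ} {d τ : ℕ}
    (hd : P.totalDegree ≤ d) (hτ : bitsize P ≤ τ) :
    N.poly (shearAt t s P) ≤ 2 ^ (τ + 3 * d) := by
  have hlin : N.poly (C t - C s * X) ≤ 2 := by
    refine (N.poly.map_sub_le _ _).trans ?_
    have := N.poly.map_mul_le (C s) X
    rw [N.poly_C] at this ⊢
    have h2 := Nat.mul_le_mul hs N.poly_X_le
    omega
  have hterm : ∀ m ∈ P.support, N.poly (C ((P.coeff m : ℤ) : R) *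
      ((C t - C s * X) ^ m 0 * X ^ m 1)) ≤ 2 ^ (τ + d) := by
    intro m hm
    have hmd := add_le_totalDegree hm
    refine (N.poly.map_mul_le _ _).trans ?_
    rw [pow_add]
    refine Nat.mul_le_mul ?_ ((N.poly.map_mul_le _ _).trans ?_)
    · rw [N.poly_C]
      exact (N.map_intCast_le _).trans (natAbs_coeff_le_of_bitsize_le hτ hm)
    · refine (Nat.mul_le_mul (N.poly.map_pow_le _ _) (N.poly.map_pow_le _ _)).trans ?_
      refine (Nat.mul_le_mul (Nat.pow_le_pow_left hlin _)
        ((Nat.pow_le_pow_left N.poly_X_le _).trans (one_pow _).le)).trans ?_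
      rw [mul_one]
      exact Nat.pow_le_pow_right (by norm_num) (by omega)
  rw [shearAt_eq_sum]
  refine (N.poly.map_sum_le _ _).trans ((Finset.sum_le_sum hterm).trans ?_)
  rw [Finset.sum_const, smul_eq_mul]
  have h1 : P.support.card ≤ (2 ^ d) ^ 2 :=
    (card_support_le P).trans (Nat.pow_le_pow_left
      ((Nat.succ_le_succ hd).trans Nat.lt_two_pow_self) 2)
  calc _ ≤ (2 ^ d) ^ 2 * 2 ^ (τ + d) := Nat.mul_le_mul_right _ h1
    _ = 2 ^ (τ + 3 * d) := by rw [← pow_mul, ← pow_add]; congr 1; ring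

lemma two_mul_le_two_pow {d : ℕ} (hd : 1 ≤ d) : 2 * d ≤ 2 ^ d := by
  induction d, hd using Nat.le_induction with
  | base => norm_num
  | succ n hn ih => rw [pow_succ]; omega

lemma LengthFn.topForm_le {P : MvPolynomial (Fin 2) ℤ} {d τ : ℕ}
    (hd : P.totalDegree ≤ d) (hτ : bitsize P ≤ τ) :
    LengthFn.int.poly (topForm P) ≤ 2 ^ (τ + 3 * d) := by
  have h := (coeff_shearAt_totalDegree (0 : ℤ[X]) X P).trans (aeval_X_left_apply _)
  rw [← h]
  refine (LengthFn.coeff_le_poly _ _ _).trans (LengthFn.poly_shearAt_le _ ?_ ?_ hd hτ)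
  · rw [LengthFn.map_zero]; exact zero_le_one
  · exact LengthFn.poly_X_le _

/-- The Sylvester matrix has order at most 2d ≤ 2^d and entries of size at most 2^(τ + 3d). -/
lemma LengthFn.shearResultant_le {P Q : MvPolynomial (Fin 2) ℤ} {d τ : ℕ} (hd1 : 1 ≤ d)
    (hPd : P.totalDegree ≤ d) (hQd : Q.totalDegree ≤ d) (hPτ : bitsize P ≤ τ)
    (hQτ : bitsize Q ≤ τ) :
    LengthFn.int.poly.poly (shearResultant P Q) ≤ 2 ^ (2 * d * (τ + 4 * d)) := by
  set N := LengthFn.int.poly.poly with hN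
  have hX : N X ≤ 1 := LengthFn.poly_X_le _
  have hCX : N (C X) ≤ 1 := by
    rw [hN, LengthFn.poly_C]
    exact LengthFn.poly_X_le _
  have hP := N.poly_shearAt_le hX hCX hPd hPτ
  have hQ := N.poly_shearAt_le hX hCX hQd hQτ
  rw [shearResultant, resultant]
  refine (N.map_det_le _ (B := 2 ^ (τ + 3 * d)) fun i j => ?_).trans ?_
  · induction j using Fin.addCases with
    | left j =>
      simp only [sylvester, Matrix.of_apply, Fin.addCases_left]
      split_ifs
      · exact (N.coeff_le_poly _ _).trans hQ
      · rw [N.map_zero]; exact Nat.zero_le _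
    | right j =>
      simp only [sylvester, Matrix.of_apply, Fin.addCases_right]
      split_ifs
      · exact (N.coeff_le_poly _ _).trans hP
      · rw [N.map_zero]; exact Nat.zero_le _
  · have h1 : P.totalDegree + Q.totalDegree ≤ 2 * d := by omega
    calc _ ≤ (2 ^ (τ + 4 * d)) ^ (P.totalDegree + Q.totalDegree) := by
          refine Nat.pow_le_pow_left ?_ _
          have : (2 : ℕ) ^ (τ + 4 * d) = 2 ^ d * 2 ^ (τ + 3 * d) := by
            rw [← pow_add]; congr 1; ring
          rw [this]
          exact Nat.mul_le_mul_right _ (h1.trans (two_mul_le_two_pow hd1))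
      _ ≤ (2 ^ (τ + 4 * d)) ^ (2 * d) := Nat.pow_le_pow_right (Nat.two_pow_pos _) h1
      _ = _ := by rw [← pow_mul, mul_comm]

lemma natDegree_coeff_mul_le {R : Type*} [CommRing R] {p q : R[X][X]} {a b : ℕ}
    (hp : ∀ k, (p.coeff k).natDegree ≤ a) (hq : ∀ k, (q.coeff k).natDegree ≤ b) (k : ℕ) :
    ((p * q).coeff k).natDegree ≤ a + b := by
  rw [coeff_mul]
  exact natDegree_sum_le_of_forall_le _ _ fun x _ =>
    natDegree_mul_le.trans (Nat.add_le_add (hp _) (hq _))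

lemma natDegree_coeff_pow_le {R : Type*} [CommRing R] {p : R[X][X]} {a : ℕ}
    (hp : ∀ k, (p.coeff k).natDegree ≤ a) (n k : ℕ) : ((p ^ n).coeff k).natDegree ≤ n * a := by
  induction n generalizing k with
  | zero =>
    rw [pow_zero, coeff_one]
    split_ifs <;> simp
  | succ n ih =>
    rw [pow_succ, Nat.succ_mul]
    exact natDegree_coeff_mul_le ih hp k

lemma natDegree_coeff_shearAt_le (P : MvPolynomial (Fin 2) ℤ) (k : ℕ) :
    ((shearAt (X : ℤ[X][X]) (C X) P).coeff k).natDegree ≤ P.totalDegree := by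
  rw [shearAt_eq_sum, finsetSum_coeff]
  refine natDegree_sum_le_of_forall_le _ _ fun m hm => ?_
  have h1 : ∀ k, ((C (X : ℤ[X][X]) - C (C X) * X).coeff k).natDegree ≤ 1 := by
    intro k
    rw [coeff_sub, coeff_C_mul, coeff_C, coeff_X]
    split_ifs <;> simp
  have h2 : ∀ k, ((X : ℤ[X][X][X]).coeff k).natDegree ≤ 0 := by
    intro k
    rw [coeff_X]
    split_ifs <;> simp
  have h3 := natDegree_coeff_mul_le (natDegree_coeff_pow_le h1 (m 0))
    (natDegree_coeff_pow_le h2 (m 1)) k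
  rw [coeff_C_mul]
  have h4 : (((P.coeff m : ℤ) : ℤ[X][X])).natDegree = 0 := natDegree_intCast _
  have h5 := add_le_totalDegree hm
  refine natDegree_mul_le.trans ?_
  omega

lemma natDegree_det_le {R : Type*} [CommRing R] {n e : ℕ} (M : Matrix (Fin n) (Fin n) R[X])
    (h : ∀ i j, (M i j).natDegree ≤ e) : M.det.natDegree ≤ n * e := by
  rw [Matrix.det_apply]
  refine natDegree_sum_le_of_forall_le _ _ fun σ _ => ?_
  have h1 : (∏ i, M (σ i) i).natDegree ≤ n * e := by
    refine (natDegree_prod_le _ _).trans ?_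
    simpa using Finset.sum_le_card_nsmul Finset.univ (fun i => (M (σ i) i).natDegree) e
      fun i _ => h _ _
  obtain h2 | h2 := Int.units_eq_one_or (Equiv.Perm.sign σ) <;> simpa [h2] using h1

lemma natDegree_shearResultant_le {P Q : MvPolynomial (Fin 2) ℤ} {d : ℕ}
    (hPd : P.totalDegree ≤ d) (hQd : Q.totalDegree ≤ d) :
    (shearResultant P Q).natDegree ≤ 2 * d ^ 2 := by
  rw [shearResultant, resultant]
  refine (natDegree_det_le _ (e := d) fun i j => ?_).trans ?_
  · induction j using Fin.addCases with
    | left j =>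
      simp only [sylvester, Matrix.of_apply, Fin.addCases_left]
      split_ifs
      · exact (natDegree_coeff_shearAt_le _ _).trans hQd
      · simp
    | right j =>
      simp only [sylvester, Matrix.of_apply, Fin.addCases_right]
      split_ifs
      · exact (natDegree_coeff_shearAt_le _ _).trans hPd
      · simp
  · calc _ ≤ (d + d) * d := Nat.mul_le_mul_right _ (Nat.add_le_add hPd hQd)
      _ = 2 * d ^ 2 := by ring

/-- A minor has order at most 2n ≤ 4d² ≤ 2^(2d), and its entries cost another factor 2n from
differentiation. This is the dominant contribution d⁴ + d³τ. -/
lemma LengthFn.minor_le {P Q : MvPolynomial (Fin 2) ℤ} {d τ : ℕ} (hd1 : 1 ≤ d)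
    (hPd : P.totalDegree ≤ d) (hQd : Q.totalDegree ≤ d) (hPτ : bitsize P ≤ τ)
    (hQτ : bitsize Q ≤ τ) {n k : ℕ} (hn : n = (shearResultant P Q).natDegree) (hk : k ≤ n + n)
    (r : Fin k → Fin n ⊕ Fin n) (c : Fin k → Fin (n + n)) :
    LengthFn.int.poly ((derivMatrix (shearResultant P Q) n).submatrix r c).det ≤
      2 ^ ((4 * d + 2 * d * (τ + 4 * d)) * (4 * d ^ 2)) := by
  set W := 2 * d * (τ + 4 * d)
  have hn' : n + n ≤ 4 * d ^ 2 := by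
    have := natDegree_shearResultant_le hPd hQd
    omega
  have hd2 : 4 * d ^ 2 ≤ 2 ^ (2 * d) := by
    have := Nat.pow_le_pow_left (two_mul_le_two_pow hd1) 2
    calc 4 * d ^ 2 = (2 * d) ^ 2 := by ring
      _ ≤ _ := this
      _ = _ := by rw [← pow_mul, mul_comm]
  refine (LengthFn.map_det_le _ _ (B := 2 ^ (2 * d) * 2 ^ W) fun i j => ?_).trans ?_
  · refine (LengthFn.derivMatrix_le _ _ _ _ _).trans (Nat.mul_le_mul (hn'.trans hd2) ?_)
    exact LengthFn.shearResultant_le hd1 hPd hQd hPτ hQτ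
  · calc _ ≤ (2 ^ (4 * d + W)) ^ k := by
          refine Nat.pow_le_pow_left ?_ _
          calc _ ≤ 2 ^ (2 * d) * (2 ^ (2 * d) * 2 ^ W) :=
                Nat.mul_le_mul_right _ (hk.trans (hn'.trans hd2))
            _ = _ := by rw [← pow_add, ← pow_add]; congr 1; ring
      _ ≤ (2 ^ (4 * d + W)) ^ (4 * d ^ 2) :=
          Nat.pow_le_pow_right (Nat.two_pow_pos _) (hk.trans hn')
      _ = _ := by rw [← pow_mul]

end Bounds

/-! ### Generic shears and reduction modulo a prime -/

section Counting

open Polynomial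

universe u

lemma exists_isAlgClosed_transcendental (K : Type u) [Field K] :
    ∃ (F : Type u) (_ : Field F) (_ : IsAlgClosed F) (_ : Algebra K F) (s : F),
      Transcendental K s := by
  refine ⟨AlgebraicClosure (RatFunc K), inferInstance, inferInstance, inferInstance,
    algebraMap (RatFunc K) _ RatFunc.X, ?_⟩
  exact (transcendental_algebraMap_iff (algebraMap (RatFunc K) _).injective).mpr
    RatFunc.transcendental_X

lemma notMem_range_of_transcendental {K F : Type*} [Field K] [Field F] [Algebra K F] {s : F}
    (hs : Transcendental K s) : s ∉ Set.range (algebraMap K F) := by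
  rintro ⟨c, rfl⟩
  exact hs (isAlgebraic_algebraMap c)

lemma aeval_ne_zero_of_transcendental {K F : Type*} [Field K] [Field F] [Algebra K F] {s : F}
    (hs : Transcendental K s) {p : ℤ[X]} (hp : p.map (Int.castRingHom K) ≠ 0) :
    aeval s p ≠ 0 := by
  intro h
  refine hp (transcendental_iff.mp hs _ ?_)
  rw [aeval_def, eval₂_map, ← h, aeval_def]
  exact congrArg (fun φ => eval₂ φ s p) (RingHom.ext_int _ _)

/-- Nonvanishing of the leading coefficient keeps the degree n, so the same integral matrix counts
the zeros in every characteristic allowed by `hchar`. -/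
lemma rank_derivMatrix_shearResultant {K F : Type*} [Field K] [IsAlgClosed K] [Field F]
    [IsAlgClosed F] [Algebra K F] {s : F} (hs : Transcendental K s)
    {P Q : MvPolynomial (Fin 2) ℤ} (hP : aeval s (topForm P) ≠ 0) (hQ : aeval s (topForm Q) ≠ 0)
    (hf : aeval s (shearResultant P Q).leadingCoeff ≠ 0)
    (hchar : ∀ k : ℕ, 0 < k → k ≤ (shearResultant P Q).natDegree → (k : F) ≠ 0) :
    (((derivMatrix (shearResultant P Q) (shearResultant P Q).natDegree).map
      (aeval s : ℤ[X] →ₐ[ℤ] F).toRingHom).rank : ℕ∞) = (shearResultant P Q).natDegree +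
      {x : Fin 2 → K | MvPolynomial.aeval x P = 0 ∧ MvPolynomial.aeval x Q = 0}.encard := by
  classical
  have hdeg := natDegree_map_of_leadingCoeff_ne_zero
    (f := (aeval s : ℤ[X] →ₐ[ℤ] F).toRingHom) (p := shearResultant P Q) hf
  have hf0 : (shearResultant P Q).map (aeval s : ℤ[X] →ₐ[ℤ] F).toRingHom ≠ 0 :=
    fun h => hf <| by
      have := congrArg (fun p => p.coeff (shearResultant P Q).natDegree) h
      rwa [coeff_map, coeff_zero] at this
  rw [encard_zeros (notMem_range_of_transcendental hs) hP hQ hf0, derivMatrix_map, ← hdeg,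
    rank_derivMatrix (IsAlgClosed.splits _) hf0 (by rwa [hdeg]), Nat.cast_add]

lemma variety_eq {R K : Type*} [CommRing R] [Field K] [Algebra R K]
    (P Q : MvPolynomial (Fin 2) R) :
    variety K P Q = {x | MvPolynomial.aeval x P = 0 ∧ MvPolynomial.aeval x Q = 0} := by
  ext x
  constructor
  · intro h
    exact ⟨h P (Ideal.subset_span (by simp)), h Q (Ideal.subset_span (by simp))⟩
  · rintro ⟨h1, h2⟩ f hf
    obtain ⟨a, b, rfl⟩ := Ideal.mem_span_pair.mp hf
    simp [h1, h2]

/-- Stated for an arbitrary ℤ-algebra instance, so that the one found on the algebraic closure of ℚ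
need not be syntactically the canonical one. -/
lemma variety_int_eq {K : Type*} [Field K] (inst : Algebra ℤ K) (P Q : MvPolynomial (Fin 2) ℤ) :
    @variety ℤ _ K _ inst P Q =
      {x | MvPolynomial.aeval x P = 0 ∧ MvPolynomial.aeval x Q = 0} := by
  obtain rfl : inst = Ring.toIntAlgebra K := Subsingleton.elim _ _
  exact variety_eq P Q

lemma aeval_reduceMod {K : Type*} [Field K] (μ : ℕ) [Algebra (ZMod μ) K] (x : Fin 2 → K)
    (P : MvPolynomial (Fin 2) ℤ) :
    MvPolynomial.aeval x (reduceMod μ P) = MvPolynomial.aeval x P := by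
  rw [reduceMod, MvPolynomial.aeval_def, MvPolynomial.eval₂_map, MvPolynomial.aeval_def]
  exact congrArg (fun φ => MvPolynomial.eval₂ φ x P) (RingHom.ext_int _ _)

lemma shearLc_eq {P : MvPolynomial (Fin 2) ℤ} (hP : P ≠ 0) :
    shearLc P = aeval (MvPolynomial.X 1 : MvPolynomial (Fin 2) ℤ) (topForm P) := by
  have h : aeval (MvPolynomial.X 1 : MvPolynomial (Fin 2) ℤ) (topForm P) ≠ 0 := by
    intro h0
    refine topForm_ne_zero hP ?_
    have h1 := congrArg (MvPolynomial.eval₂Hom (Int.castRingHom ℤ[X]) (fun _ => X)) h0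
    rw [map_zero, aeval_def, hom_eval₂] at h1
    rw [← h1, MvPolynomial.eval₂Hom_X', RingHom.ext_int (RingHom.comp _ _) C]
    exact eval₂_C_X.symm
  rw [shearLc, shear_eq_shearAt, leadingCoeff, natDegree_shearAt h]
  exact coeff_shearAt_totalDegree _ _ P

lemma reduceMod_shearLc_ne_zero {F : Type*} [Field F] {μ : ℕ} [Algebra (ZMod μ) F] {s : F}
    {P : MvPolynomial (Fin 2) ℤ} (hP : P ≠ 0) (h : aeval s (topForm P) ≠ 0) :
    reduceMod μ (shearLc P) ≠ 0 := by
  intro h0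
  refine h ?_
  have h1 := congrArg (MvPolynomial.aeval (fun _ => s)) h0
  rw [aeval_reduceMod, map_zero, shearLc_eq hP, aeval_def, MvPolynomial.aeval_def,
    ← MvPolynomial.coe_eval₂Hom, hom_eval₂, MvPolynomial.eval₂Hom_X'] at h1
  rw [← h1, aeval_def]
  exact congrArg (fun φ => eval₂ φ s (topForm P)) (RingHom.ext_int _ _)

end Counting

/-! ### Counting the unlucky primes -/

section Main

open Polynomial

/-- A nonzero integer of controlled size that is divisible by all the large unlucky primes. -/
lemma exists_multiple_of_unlucky {d τ : ℕ} {P Q : MvPolynomial (Fin 2) ℤ} (hd : 2 ≤ d)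
    (hP0 : P ≠ 0) (hQ0 : Q ≠ 0) (hPQ : IsRelPrime P Q) (hPd : P.totalDegree ≤ d)
    (hQd : Q.totalDegree ≤ d) (hPτ : bitsize P ≤ τ) (hQτ : bitsize Q ≤ τ) :
    ∃ m : ℕ, m ≠ 0 ∧ m ≤ 2 ^ ((τ + 3 * d) + (τ + 3 * d) + 2 * d * (τ + 4 * d) +
        (4 * d + 2 * d * (τ + 4 * d)) * (4 * d ^ 2)) ∧
      ∀ μ ∈ unluckyPrimes d P Q, 2 * d ^ 4 < μ → μ ∣ m := by
  set f := shearResultant P Q with hf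
  set n := f.natDegree with hn
  have hf0 : f ≠ 0 := shearResultant_ne_zero hP0 hQ0 hPQ
  obtain ⟨F₀, _, _, _, s₀, hs₀⟩ := exists_isAlgClosed_transcendental (AlgebraicClosure ℚ)
  set φ₀ : ℤ[X] →+* F₀ := (aeval s₀ : ℤ[X] →ₐ[ℤ] F₀).toRingHom
  have hφ₀ : ∀ p : ℤ[X], p ≠ 0 → aeval s₀ p ≠ 0 := fun p hp =>
    aeval_ne_zero_of_transcendental hs₀
      ((Polynomial.map_ne_zero_iff (RingHom.injective_int _)).mpr hp)
  have hinj : Function.Injective φ₀ := by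
    rw [injective_iff_map_eq_zero]
    intro p hp
    by_contra h
    exact hφ₀ p h hp
  set A := derivMatrix f n
  obtain ⟨r, c, hrc⟩ := exists_submatrix_det_ne_zero (A.map φ₀)
  have hdet : (A.submatrix r c).det ≠ 0 := by
    intro h
    rw [Matrix.submatrix_map, ← RingHom.mapMatrix_apply, ← RingHom.map_det, h, map_zero] at hrc
    exact hrc rfl
  set D := (A.submatrix r c).det with hD
  set G := topForm P * topForm Q * f.leadingCoeff * D with hG
  have hG0 : G ≠ 0 := mul_ne_zero (mul_ne_zero (mul_ne_zero (topForm_ne_zero hP0)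
    (topForm_ne_zero hQ0)) (leadingCoeff_ne_zero.mpr hf0)) hdet
  -- A prime not dividing the leading coefficient of `G` leaves `G` nonzero modulo μ, hence all four
  -- factors nonzero at a transcendental s.
  refine ⟨(G.coeff G.natDegree).natAbs, by simpa using hG0, ?_, ?_⟩
  · have hrank : (A.map φ₀).rank ≤ n + n := by
      simpa using Matrix.rank_le_card_width (A.map φ₀)
    refine (LengthFn.int.coeff_le_poly G _).trans ?_
    set N := LengthFn.int.poly
    rw [pow_add, pow_add, pow_add]
    refine (N.map_mul_le _ _).trans (Nat.mul_le_mul ((N.map_mul_le _ _).trans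
      (Nat.mul_le_mul ((N.map_mul_le _ _).trans (Nat.mul_le_mul ?_ ?_)) ?_)) ?_)
    · exact LengthFn.topForm_le hPd hPτ
    · exact LengthFn.topForm_le hQd hQτ
    · exact (N.coeff_le_poly _ _).trans
        (LengthFn.shearResultant_le (by omega) hPd hQd hPτ hQτ)
    · exact LengthFn.minor_le (by omega) hPd hQd hPτ hQτ rfl hrank r c
  · rintro μ ⟨hμ, hunl⟩ hlt
    by_contra hndvd
    refine hunl ⟨hlt, ?_, ?_⟩ <;>
      obtain ⟨F₁, _, _, _, s₁, hs₁⟩ :=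
        exists_isAlgClosed_transcendental (AlgebraicClosure (ZMod μ))
    all_goals
      have hchK : CharP (AlgebraicClosure (ZMod μ)) μ :=
        charP_of_injective_algebraMap (algebraMap (ZMod μ) _).injective μ
      have hGμ : aeval s₁ G ≠ 0 := by
        refine aeval_ne_zero_of_transcendental hs₁ fun h => hndvd ?_
        have h1 := congrArg (fun p => p.coeff G.natDegree) h
        simp only [coeff_map, coeff_zero, eq_intCast] at h1
        rw [CharP.intCast_eq_zero_iff _ μ] at h1
        exact Int.natCast_dvd.mp h1
      rw [hG, map_mul, map_mul, map_mul] at hGμ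
      have h1 := right_ne_zero_of_mul hGμ
      have h2 := right_ne_zero_of_mul (left_ne_zero_of_mul hGμ)
      have h3 := right_ne_zero_of_mul (left_ne_zero_of_mul (left_ne_zero_of_mul hGμ))
      have h4 := left_ne_zero_of_mul (left_ne_zero_of_mul (left_ne_zero_of_mul hGμ))
    · let _ : Algebra (ZMod μ) F₁ :=
        ((algebraMap (AlgebraicClosure (ZMod μ)) F₁).comp (algebraMap (ZMod μ) _)).toAlgebra
      exact mul_ne_zero (reduceMod_shearLc_ne_zero hP0 h4) (reduceMod_shearLc_ne_zero hQ0 h3)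
    · have hchF : CharP F₁ μ :=
        charP_of_injective_algebraMap (algebraMap (AlgebraicClosure (ZMod μ)) F₁).injective μ
      have hcharZero : CharZero F₀ :=
        charZero_of_injective_algebraMap (algebraMap (AlgebraicClosure ℚ) F₀).injective
      have hrk := rank_map_eq A φ₀ (aeval s₁ : ℤ[X] →ₐ[ℤ] F₁).toRingHom hinj r c h1
      have e₀ := rank_derivMatrix_shearResultant hs₀ (hφ₀ _ (topForm_ne_zero hP0))
        (hφ₀ _ (topForm_ne_zero hQ0)) (hφ₀ _ (leadingCoeff_ne_zero.mpr hf0))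
        (fun k hk _ => Nat.cast_ne_zero.mpr hk.ne')
      -- The threshold ensures that the characteristic exceeds the degree: n ≤ 2d² ≤ 2d⁴ < μ.
      have e₁ := rank_derivMatrix_shearResultant hs₁ h4 h3 h2 (fun k hk hkn h0 => by
        have h5 := Nat.le_of_dvd hk ((CharP.cast_eq_zero_iff F₁ μ k).mp h0)
        have h6 := natDegree_shearResultant_le hPd hQd
        have h7 : d ^ 2 ≤ d ^ 4 := Nat.pow_le_pow_right (by omega) (by norm_num)
        omega)
      have e₂ := e₀.symm.trans ((congrArg (Nat.cast : ℕ → ℕ∞) hrk).symm.trans e₁)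
      have e₃ := WithTop.add_left_cancel (ENat.natCast_ne_top _) e₂
      rw [variety_int_eq, variety_eq]
      simp only [aeval_reduceMod]
      exact e₃

lemma encard_unluckyPrimes_le {d τ : ℕ} {P Q : MvPolynomial (Fin 2) ℤ} (hd : 2 ≤ d)
    (hP0 : P ≠ 0) (hQ0 : Q ≠ 0) (hPQ : IsRelPrime P Q) (hPd : P.totalDegree ≤ d)
    (hQd : Q.totalDegree ≤ d) (hPτ : bitsize P ≤ τ) (hQτ : bitsize Q ≤ τ) :
    (unluckyPrimes d P Q).encard ≤ (64 * (d ^ 4 + d ^ 3 * τ) : ℕ) := by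
  obtain ⟨m, hm0, hm, hdvd⟩ := exists_multiple_of_unlucky hd hP0 hQ0 hPQ hPd hQd hPτ hQτ
  have hsub : unluckyPrimes d P Q ⊆ ↑(Finset.Icc 1 (2 * d ^ 4) ∪ m.primeFactors) := by
    intro μ hμ
    have hp : μ.Prime := hμ.choose.out
    rw [Finset.mem_coe, Finset.mem_union, Finset.mem_Icc, Nat.mem_primeFactors]
    by_cases h : μ ≤ 2 * d ^ 4
    · exact Or.inl ⟨hp.one_le, h⟩
    · exact Or.inr ⟨hp, hdvd μ hμ (not_le.mp h), hm0⟩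
  refine (Set.encard_le_encard hsub).trans ?_
  rw [Set.encard_coe_eq_coe_finsetCard, Nat.cast_le]
  refine (Finset.card_union_le _ _).trans ?_
  rw [Nat.card_Icc, Nat.add_sub_cancel]
  refine (Nat.add_le_add_left (card_primeFactors_le_of_le_two_pow hm0 hm) _).trans ?_
  -- The total is 34d⁴ + 16d³ + 8d² + 6d + 8d³τ + 2dτ + 2τ; as d ≥ 2, the lower terms are absorbed
  -- with room to spare in the constant 64.
  have h1 : 8 * d ≤ d ^ 4 := by
    rw [pow_succ]; exact Nat.mul_le_mul_right _ (Nat.pow_le_pow_left hd 3)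
  have h2 : 4 * d ^ 2 ≤ d ^ 4 := by
    rw [show d ^ 4 = d ^ 2 * d ^ 2 by ring]
    exact Nat.mul_le_mul_right _ (Nat.pow_le_pow_left hd 2)
  have h3 : 2 * d ^ 3 ≤ d ^ 4 := by
    rw [pow_succ' d 3]; exact Nat.mul_le_mul_right _ hd
  have h4 : 8 * τ ≤ d ^ 3 * τ := Nat.mul_le_mul_right _ (Nat.pow_le_pow_left hd 3)
  have h5 : 4 * (d * τ) ≤ d ^ 3 * τ := by
    rw [show d ^ 3 * τ = d ^ 2 * (d * τ) by ring]
    exact Nat.mul_le_mul_right _ (Nat.pow_le_pow_left hd 2)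
  linarith

end Main

end LuckyPrimes

theorem mainTheorem4 :
    ∃ Ξ : ℕ → ℕ → ℕ,
      Primrec₂ Ξ ∧
      LuckyPrimes.IsSoftO (fun d τ => (Ξ d τ : ℝ))
        (fun d τ => (d : ℝ) ^ 4 + (d : ℝ) ^ 3 * (τ : ℝ)) ∧
      ∀ (d τ : ℕ) (P Q : MvPolynomial (Fin 2) ℤ),
        2 ≤ d → P ≠ 0 → Q ≠ 0 → IsRelPrime P Q →
        P.totalDegree ≤ d → Q.totalDegree ≤ d →
        LuckyPrimes.bitsize P ≤ τ → LuckyPrimes.bitsize Q ≤ τ →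
        (LuckyPrimes.unluckyPrimes d P Q).encard ≤ (Ξ d τ : ℕ∞) := by
  -- The logarithmic exponent is 0: this bound needs no polylogarithmic factor.
  refine ⟨fun d τ => 64 * (d ^ 4 + d ^ 3 * τ), ?_, ⟨64, 0, fun d τ _ _ => ?_⟩, ?_⟩
  · have hpow : ∀ k : ℕ, Primrec fun p : ℕ × ℕ => p.1 ^ k := by
      intro k
      induction k with
      | zero => simpa using Primrec.const 1
      | succ k ih => simpa only [pow_succ] using Primrec.nat_mul.comp ih Primrec.fst
    exact Primrec.nat_mul.comp (Primrec.const 64)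
      (Primrec.nat_add.comp (hpow 4) (Primrec.nat_mul.comp (hpow 3) Primrec.snd))
  · rw [pow_zero, mul_one, abs_of_nonneg (by positivity), abs_of_nonneg (by positivity)]
    push_cast
    exact le_rfl
  · intro d τ P Q hd hP hQ hPQ hPd hQd hPτ hQτ
    exact LuckyPrimes.encard_unluckyPrimes_le hd hP hQ hPQ hPd hQd hPτ hQτ
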